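/- Let $\mu$ denote the Möbius function. For real $x \ge 1$ let $$\mathcal F(x)=\sum_{n\le x}\mu(n)\log\frac{x}{n},$$ the sum being over positive integers $n \le x$, and for real $x\ge 0$ let $$\mathcal H(x)=\frac{\mathcal F\left(e^{\sqrt{x}}\right)}{e^{\sqrt{x}}}.$$ Put $\ell=\limsup_{x\to+\infty}|\mathcal H(x)|$. Then $\ell=0$. -/

import Mathlib

/-- `F(x) = ∑_{1 ≤ n ≤ x} μ(n) log(x / n)`. -/
noncomputable def calF (x : ℝ) : ℝ :=
  ∑ n ∈ Finset.Icc 1 ⌊x⌋₊, (ArithmeticFunction.moebius n : ℝ) * Real.log (x / n)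

/-- `H(x) = F(e^{√x}) / e^{√x}` (meant for `x ≥ 0`). -/
noncomputable def calH (x : ℝ) : ℝ :=
  calF (Real.exp (Real.sqrt x)) / Real.exp (Real.sqrt x)

/-- `ℓ`, the upper limit of `|H(x)|` as `x → +∞`, taken in the extended reals, where it always
exists. -/
noncomputable def ell : EReal :=
  Filter.limsup (fun x : ℝ => ((|calH x| : ℝ) : EReal)) Filter.atTop

open Filter Topology MeasureTheory Complex FourierTransform Set

/-! Let h(t) = F(e^t)/e^t, so that H(x) = h(√x); it suffices that h tends to 0. Elementary estimates
give |h| ≤ 1 and make h 2-Lipschitz. Its Laplace transform is 1/(ζ(1+z)(1+z)^2), which extends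
continuously to Re z ≥ 0 because ζ has no zero on Re s = 1 and its pole at 1 only makes 1/ζ vanish
there. The Tauberian theorem `tendsto_zero_of_laplace_continuousOn` concludes: Riemann–Lebesgue
sends smoothed averages of h to 0, and the Lipschitz bound keeps h close to its averages over short
windows. -/

/-! ### The Tauberian theorem -/

theorem integrable_mul_exp_neg_of_bounded {h : ℝ → ℝ} {C ε : ℝ} (hcont : Continuous h)
    (hbd : ∀ t, |h t| ≤ C) (hneg : ∀ t ≤ 0, h t = 0) (hε : 0 < ε) :
    Integrable (fun u : ℝ => (h u : ℂ) * cexp (-(ε * u))) := by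
  have hi : IntegrableOn (fun u : ℝ => (h u : ℂ) * cexp (-(ε * u))) (Ioi 0) := by
    have h1 : IntegrableOn (fun u : ℝ => C * Real.exp (-ε * u)) (Ioi 0) :=
      (exp_neg_integrableOn_Ioi 0 hε).const_mul C
    refine Integrable.mono' h1 (by fun_prop) (ae_of_all _ fun u => ?_)
    rw [norm_mul, Complex.norm_exp, Complex.norm_real]
    have : (-((ε : ℂ) * u)).re = -ε * u := by simp
    rw [this]
    exact mul_le_mul_of_nonneg_right (hbd u) (Real.exp_pos _).le
  refine (integrableOn_iff_integrable_of_support_subset fun u hu => ?_).1 hi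
  by_contra hu'
  exact hu (by simp [hneg u (not_lt.1 hu')])

theorem fourier_mul_fourierChar (φ : ℝ → ℂ) (t u : ℝ) :
    𝓕 (fun y : ℝ => (Real.fourierChar (t * y) : ℂ) * φ y) u = 𝓕 φ (u - t) := by
  simp only [Real.fourier_real_eq, Circle.smul_def, smul_eq_mul, ← mul_assoc]
  congr 1 with y
  rw [← Circle.coe_mul, ← AddChar.map_add_eq_mul]
  congr 4
  ring

theorem fourier_mul_exp_neg {h : ℝ → ℝ} (hneg : ∀ t ≤ 0, h t = 0) (ε y : ℝ) :
    𝓕 (fun u : ℝ => (h u : ℂ) * cexp (-(ε * u))) y =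
      ∫ u in Ioi (0 : ℝ), (h u : ℂ) * cexp (-((ε + 2 * Real.pi * y * I) * u)) := by
  rw [Real.fourier_real_eq, setIntegral_eq_integral_of_forall_compl_eq_zero]
  · congr 1 with u
    rw [Circle.smul_def, Real.fourierChar_apply, smul_eq_mul, mul_left_comm, ← Complex.exp_add]
    congr 2
    push_cast
    ring
  · intro u hu
    simp [hneg u (not_lt.1 hu)]

/-- Damping h by e^{-εu} permits moving the Fourier transform from φ to h, where it becomes G(ε +
2πiy). Letting ε → 0 leaves a Fourier integral of the compactly supported continuous function φ(y)
G(2πiy), to which Riemann–Lebesgue applies. -/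
theorem tendsto_integral_fourier_mul_of_laplace {h : ℝ → ℝ} {C : ℝ} {G : ℂ → ℂ}
    (hcont : Continuous h) (hbd : ∀ t, |h t| ≤ C) (hneg : ∀ t ≤ 0, h t = 0)
    (hG : ContinuousOn G {z | 0 ≤ z.re})
    (hlap : ∀ z : ℂ, 0 < z.re → ∫ u in Ioi (0 : ℝ), (h u : ℂ) * cexp (-(z * u)) = G z)
    (φ : SchwartzMap ℝ ℂ) (hφ : HasCompactSupport φ) :
    Tendsto (fun t : ℝ => ∫ u : ℝ, 𝓕 (φ : ℝ → ℂ) (u - t) * h u) atTop (𝓝 0) := by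
  have hK : Integrable (𝓕 (φ : ℝ → ℂ)) := by
    rw [← SchwartzMap.fourier_coe]; exact (𝓕 φ).integrable
  have hKc : Continuous (𝓕 (φ : ℝ → ℂ)) := by
    rw [← SchwartzMap.fourier_coe]; exact (𝓕 φ).continuous
  -- The absolute value keeps the argument in the closed half-plane, so Γ is continuous on the whole
  -- plane.
  set Γ : ℝ → ℝ → ℂ := fun x y => G (|x| + 2 * Real.pi * y * I) with hΓ
  have hΓc : Continuous fun p : ℝ × ℝ => Γ p.1 p.2 := by
    refine hG.comp_continuous (by fun_prop) fun p => ?_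
    simp
  have main : ∀ t : ℝ, ∫ u : ℝ, 𝓕 (φ : ℝ → ℂ) (u - t) * h u =
      ∫ y : ℝ, (Real.fourierChar (t * y) : ℂ) * φ y * Γ 0 y := by
    intro t
    have hfc : Continuous fun y : ℝ => (Real.fourierChar (t * y) : ℂ) * φ y := by
      have := φ.continuous
      have := Real.continuous_fourierChar
      fun_prop
    have hf : Integrable fun y : ℝ => (Real.fourierChar (t * y) : ℂ) * φ y :=
      φ.integrable.mono hfc.aestronglyMeasurable (ae_of_all _ fun y => by
        rw [norm_mul, Circle.norm_coe, one_mul])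
    have key : ∀ ε : ℝ, 0 < ε → ∫ u : ℝ, 𝓕 (φ : ℝ → ℂ) (u - t) * ((h u : ℂ) * cexp (-(ε * u))) =
        ∫ y : ℝ, (Real.fourierChar (t * y) : ℂ) * φ y * Γ ε y := by
      intro ε hε
      have := VectorFourier.integral_fourierIntegral_smul_eq_flip (L := innerₗ ℝ) (μ := volume)
        (ν := volume) Real.continuous_fourierChar continuous_inner hf
        (integrable_mul_exp_neg_of_bounded hcont hbd hneg hε)
      have e1 : ∀ u, VectorFourier.fourierIntegral Real.fourierChar volume (innerₗ ℝ)
          (fun y : ℝ => (Real.fourierChar (t * y) : ℂ) * φ y) u = 𝓕 (φ : ℝ → ℂ) (u - t) :=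
        fun u => fourier_mul_fourierChar φ t u
      have e2 : ∀ y, VectorFourier.fourierIntegral Real.fourierChar volume (innerₗ ℝ).flip
          (fun u : ℝ => (h u : ℂ) * cexp (-(ε * u))) y = Γ ε y := by
        intro y
        rw [flip_innerₗ]
        refine (fourier_mul_exp_neg hneg ε y).trans ?_
        rw [hlap _ (by simpa using hε), hΓ]
        simp [abs_of_pos hε]
      simpa only [e1, e2, smul_eq_mul] using this
    have hL : Tendsto (fun ε : ℝ => ∫ u : ℝ, 𝓕 (φ : ℝ → ℂ) (u - t) *
        ((h u : ℂ) * cexp (-(ε * u)))) (𝓝[>] 0) (𝓝 (∫ u : ℝ, 𝓕 (φ : ℝ → ℂ) (u - t) * h u)) := by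
      refine tendsto_integral_filter_of_dominated_convergence
        (fun u => ‖𝓕 (φ : ℝ → ℂ) (u - t)‖ * C) ?_ ?_ ?_ ?_
      · exact Eventually.of_forall fun ε => by fun_prop
      · filter_upwards [self_mem_nhdsWithin] with ε (hε : 0 < ε)
        refine ae_of_all _ fun u => ?_
        rw [norm_mul]
        gcongr
        rcases le_or_gt u 0 with hu | hu
        · simpa [hneg u hu] using (abs_nonneg _).trans (hbd u)
        · rw [norm_mul, Complex.norm_exp, Complex.norm_real]
          have : (-((ε : ℂ) * u)).re ≤ 0 := by simp; positivity
          calc _ ≤ |h u| * 1 := by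
                gcongr
                · exact le_rfl
                · exact Real.exp_le_one_iff.2 this
            _ ≤ C := by simpa using hbd u
      · exact ((hK.comp_sub_right t).norm).mul_const C
      · refine ae_of_all _ fun u => ?_
        have : Continuous fun ε : ℝ => 𝓕 (φ : ℝ → ℂ) (u - t) * ((h u : ℂ) * cexp (-(ε * u))) := by
          fun_prop
        simpa using (this.tendsto 0).mono_left nhdsWithin_le_nhds
    have hR : Tendsto (fun ε : ℝ => ∫ y : ℝ, (Real.fourierChar (t * y) : ℂ) * φ y * Γ ε y)
        (𝓝[>] 0) (𝓝 (∫ y : ℝ, (Real.fourierChar (t * y) : ℂ) * φ y * Γ 0 y)) := by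
      have e : ∀ ε : ℝ, ∫ y : ℝ, (Real.fourierChar (t * y) : ℂ) * φ y * Γ ε y =
          ∫ y in tsupport φ, (Real.fourierChar (t * y) : ℂ) * φ y * Γ ε y := by
        intro ε
        rw [setIntegral_eq_integral_of_forall_compl_eq_zero]
        intro y hy
        simp [image_eq_zero_of_notMem_tsupport hy]
      simp_rw [e]
      have : Continuous fun ε : ℝ =>
          ∫ y in tsupport φ, (Real.fourierChar (t * y) : ℂ) * φ y * Γ ε y := by
        refine continuous_parametric_integral_of_continuous ?_ hφ
        exact (hfc.comp continuous_snd).mul hΓc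
      exact (this.tendsto 0).mono_left nhdsWithin_le_nhds
    refine tendsto_nhds_unique hL (hR.congr' ?_)
    filter_upwards [self_mem_nhdsWithin] with ε hε using (key ε hε).symm
  simp_rw [main]
  have RL := (Real.zero_at_infty_fourier fun y => φ y * Γ 0 y).comp
    (tendsto_neg_atTop_atBot.mono_right atBot_le_cocompact)
  refine RL.congr fun t => ?_
  rw [Function.comp_apply, Real.fourier_real_eq]
  congr 1 with y
  rw [Circle.smul_def, smul_eq_mul, mul_assoc]
  congr 4
  ring

theorem exists_schwartz_hasCompactSupport_eq_one :
    ∃ φ : SchwartzMap ℝ ℂ, HasCompactSupport φ ∧ φ 0 = 1 := by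
  let b : ContDiffBump (0 : ℝ) := default
  have h1 : HasCompactSupport fun x => ((b x : ℝ) : ℂ) :=
    b.hasCompactSupport.comp_left (g := ((↑) : ℝ → ℂ)) (by simp)
  have h2 : ContDiff ℝ (⊤ : ℕ∞) fun x => ((b x : ℝ) : ℂ) :=
    Complex.ofRealCLM.contDiff.comp b.contDiff
  refine ⟨h1.toSchwartzMap h2, h1, ?_⟩
  have : b 0 = 1 := b.eventuallyEq_one.eq_of_nhds
  simpa using congrArg ((↑) : ℝ → ℂ) this

/-- A Tauberian theorem: a bounded Lipschitz function whose Laplace transform extends continuously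
to the closed right half-plane tends to zero. -/
theorem tendsto_zero_of_laplace_continuousOn {h : ℝ → ℝ} {C L : ℝ} {G : ℂ → ℂ}
    (hbd : ∀ t, |h t| ≤ C) (hlip : ∀ s t, |h s - h t| ≤ L * |s - t|)
    (hneg : ∀ t ≤ 0, h t = 0) (hG : ContinuousOn G {z | 0 ≤ z.re})
    (hlap : ∀ z : ℂ, 0 < z.re → ∫ u in Ioi (0 : ℝ), (h u : ℂ) * cexp (-(z * u)) = G z) :
    Tendsto h atTop (𝓝 0) := by
  have hcont : Continuous h := by
    refine LipschitzWith.continuous (K := L.toNNReal) (LipschitzWith.of_dist_le_mul fun s t => ?_)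
    rw [Real.dist_eq, Real.dist_eq]
    exact (hlip s t).trans (by gcongr; exact Real.le_coe_toNNReal L)
  obtain ⟨φ, hφ, hφ0⟩ := exists_schwartz_hasCompactSupport_eq_one
  set K : ℝ → ℂ := 𝓕 (φ : ℝ → ℂ) with hKdef
  have hK : Integrable K := by
    rw [hKdef, ← SchwartzMap.fourier_coe]; exact (𝓕 φ).integrable
  have hKc : Continuous K := by
    rw [hKdef, ← SchwartzMap.fourier_coe]; exact (𝓕 φ).continuous
  have hKm : Integrable fun v => |v| * ‖K v‖ := by
    have := (𝓕 φ).integrable_pow_mul volume 1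
    simp only [pow_one, Real.norm_eq_abs, SchwartzMap.fourier_coe] at this
    exact this
  -- Fourier inversion at 0: the integral of K is φ(0).
  have hK1 : ∫ v, K v = 1 := by
    have := φ.continuous.fourierInv_fourier_eq φ.integrable hK
    have h0 := congrFun this 0
    rw [Real.fourierInv_eq'] at h0
    simpa [hφ0] using h0
  set A : ℝ := ∫ v, |v| * ‖K v‖ with hA
  -- Stretching h by c divides its Lipschitz constant by c, and its transform becomes c G(cz). The
  -- term 1/c bounds the average, which tends to 0; L/c * A bounds the distance to that average.
  have scaled : ∀ c : ℝ, 0 < c → ∀ᶠ t in atTop, |h (t / c)| ≤ 1 / c + L / c * A := by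
    intro c hc
    have hT := tendsto_integral_fourier_mul_of_laplace (h := fun t => h (t / c)) (C := C)
      (G := fun z => c * G (c * z)) (by fun_prop) (fun t => hbd _)
      (fun t ht => hneg _ (div_nonpos_of_nonpos_of_nonneg ht hc.le))
      (by
        refine continuousOn_const.mul (hG.comp (by fun_prop) fun z hz => ?_)
        have hz' : 0 ≤ z.re := hz
        simp only [mem_ofPred_eq, re_ofReal_mul]
        positivity)
      (by
        intro z hz
        rw [← hlap (c * z) (by simpa using mul_pos hc hz)]
        have := integral_comp_mul_left_Ioi
          (fun u : ℝ => (h (u / c) : ℂ) * cexp (-(z * u))) 0 hc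
        rw [mul_zero] at this
        have h2 : ∫ u in Ioi (0 : ℝ), (h u : ℂ) * cexp (-(c * z * u)) =
            c⁻¹ • ∫ u in Ioi (0 : ℝ), (h (u / c) : ℂ) * cexp (-(z * u)) := by
          rw [← this]
          refine setIntegral_congr_fun measurableSet_Ioi fun u _ => ?_
          rw [mul_div_cancel_left₀ _ hc.ne']
          congr 3
          push_cast
          ring
        rw [h2, Complex.real_smul, ← mul_assoc, ← Complex.ofReal_mul,
          mul_inv_cancel₀ hc.ne', Complex.ofReal_one, one_mul]) φ hφ
    filter_upwards [(tendsto_zero_iff_norm_tendsto_zero.1 hT).eventually_le_const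
      (show (0 : ℝ) < 1 / c by positivity)] with t ht
    have hint : Integrable fun u => K (u - t) * (h (u / c) : ℂ) :=
      (hK.comp_sub_right t).mul_bdd (c := C) (by fun_prop) (ae_of_all _ fun u => by simpa using hbd _)
    have hint2 : Integrable fun u => K (u - t) * (h (t / c) : ℂ) :=
      (hK.comp_sub_right t).mul_const _
    have e : (h (t / c) : ℂ) = ∫ u, K (u - t) * (h (t / c) : ℂ) := by
      rw [integral_mul_const, integral_sub_right_eq_self (fun u => K u) t, hK1, one_mul]
    have e2 : ‖(∫ u, K (u - t) * (h (t / c) : ℂ)) - ∫ u, K (u - t) * (h (u / c) : ℂ)‖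
        ≤ L / c * A := by
      rw [← integral_sub hint2 hint, hA, ← integral_sub_right_eq_self (fun v => |v| * ‖K v‖) t, ← integral_const_mul]
      refine norm_integral_le_of_norm_le ((hKm.comp_sub_right t).const_mul _)
        (ae_of_all _ fun u => ?_)
      rw [← mul_sub, norm_mul, ← Complex.ofReal_sub, Complex.norm_real, Real.norm_eq_abs]
      have := hlip (t / c) (u / c)
      rw [← sub_div, abs_div, abs_of_pos hc, abs_sub_comm t u] at this
      calc ‖K (u - t)‖ * |h (t / c) - h (u / c)| ≤ ‖K (u - t)‖ * (L * (|u - t| / c)) := by gcongr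
        _ = _ := by ring
    calc |h (t / c)| = ‖(h (t / c) : ℂ)‖ := by simp
      _ = ‖(∫ u, K (u - t) * (h (u / c) : ℂ)) + ((∫ u, K (u - t) * (h (t / c) : ℂ)) -
          ∫ u, K (u - t) * (h (u / c) : ℂ))‖ := by rw [add_sub_cancel, ← e]
      _ ≤ _ := (norm_add_le _ _).trans (add_le_add ht e2)
  rw [Metric.tendsto_nhds]
  intro ε hε
  have hlim : Tendsto (fun c : ℝ => 1 / c + L / c * A) atTop (𝓝 0) := by
    simpa using ((tendsto_const_nhds (x := (1 : ℝ))).div_atTop tendsto_id).add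
      (((tendsto_const_nhds (x := L)).div_atTop tendsto_id).mul_const A)
  obtain ⟨c, hc1, hc⟩ := ((hlim.eventually_lt_const hε).and (eventually_gt_atTop 0)).exists
  filter_upwards [(tendsto_id.atTop_mul_const hc).eventually (scaled c hc)] with t ht
  rw [id, mul_div_cancel_right₀ _ hc.ne'] at ht
  simpa using ht.trans_lt hc1

/-! ### Laplace transforms of ramps -/

theorem integrableOn_Ioi_mul_exp_neg {x : ℝ} (hx : 0 < x) :
    IntegrableOn (fun t : ℝ => t * Real.exp (-(x * t))) (Ioi 0) := by
  -- A non-integrable function has integral 0 by convention, so a nonzero value suffices.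
  refine Integrable.of_integral_ne_zero ?_
  have := Real.integral_rpow_mul_exp_neg_mul_Ioi (a := 2) (r := x) (by norm_num) hx
  norm_num at this
  rw [this]
  positivity

theorem integrable_ramp_mul_exp_neg {w : ℂ} (hw : 0 < w.re) :
    Integrable (fun t : ℝ => ((max t 0 : ℝ) : ℂ) * cexp (-(w * t))) := by
  have hi : IntegrableOn (fun t : ℝ => ((max t 0 : ℝ) : ℂ) * cexp (-(w * t))) (Ioi 0) := by
    refine (integrableOn_Ioi_mul_exp_neg hw).mono' (by fun_prop) ?_
    refine (ae_restrict_iff' measurableSet_Ioi).2 (ae_of_all _ fun t ht => ?_)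
    have ht' : 0 < t := ht
    rw [norm_mul, Complex.norm_exp, Complex.norm_real, max_eq_left ht'.le, Real.norm_eq_abs,
      abs_of_pos ht']
    simp
  refine (integrableOn_iff_integrable_of_support_subset fun t ht => ?_).1 hi
  by_contra ht'
  rw [mem_Ioi, not_lt] at ht'
  exact ht (by simp [ht'])

theorem integral_ramp_mul_exp_neg {w : ℂ} (hw : 0 < w.re) :
    ∫ t : ℝ, ((max t 0 : ℝ) : ℂ) * cexp (-(w * t)) = 1 / w ^ 2 := by
  have hw0 : w ≠ 0 := fun h => by simp [h] at hw
  rw [← setIntegral_eq_integral_of_forall_compl_eq_zero (s := Ioi 0)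
    (fun t ht => by
    rw [mem_Ioi, not_lt] at ht
    simp [ht])]
  -- This function is an antiderivative of t e^{-wt}, with value -1/w^2 at 0.
  have hlim : Tendsto (fun t : ℝ => -((t : ℂ) / w + 1 / w ^ 2) * cexp (-(w * t))) atTop (𝓝 0) := by
    have h1 := Real.tendsto_pow_mul_exp_neg_atTop_nhds_zero 1
    have h0 := Real.tendsto_pow_mul_exp_neg_atTop_nhds_zero 0
    have hx : Tendsto (fun t : ℝ => w.re * t) atTop atTop := tendsto_id.const_mul_atTop hw
    have h2 := ((h1.comp hx).mul_const (1 / (w.re * ‖w‖))).add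
      ((h0.comp hx).mul_const (1 / ‖w‖ ^ 2))
    simp only [zero_mul, add_zero] at h2
    refine squeeze_zero_norm' ?_ h2
    filter_upwards [eventually_ge_atTop 0] with t ht
    rw [norm_mul, norm_neg, Complex.norm_exp]
    have e : (-(w * (t : ℂ))).re = -(w.re * t) := by simp
    have e1 : ‖(t : ℂ) / w + 1 / w ^ 2‖ ≤ t / ‖w‖ + 1 / ‖w‖ ^ 2 := by
      refine (norm_add_le _ _).trans (le_of_eq ?_)
      simp [abs_of_nonneg ht]
    rw [e]
    refine (mul_le_mul_of_nonneg_right e1 (Real.exp_pos _).le).trans (le_of_eq ?_)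
    have : w.re ≠ 0 := hw.ne'
    have : ‖w‖ ≠ 0 := norm_ne_zero_iff.2 hw0
    simp only [Function.comp_apply]
    field_simp
  have hd : ∀ t ∈ Ioi (0 : ℝ), HasDerivAt
      (fun t : ℝ => -((t : ℂ) / w + 1 / w ^ 2) * cexp (-(w * t)))
      (((max t 0 : ℝ) : ℂ) * cexp (-(w * t))) t := by
    intro t ht
    have hid : HasDerivAt (fun t : ℝ => (t : ℂ)) 1 t := Complex.ofRealCLM.hasDerivAt
    have h1 := ((hid.div_const w).add_const (1 / w ^ 2)).neg.mul (hid.const_mul w).neg.cexp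
    refine h1.congr_deriv ?_
    simp only [Pi.neg_apply]
    rw [max_eq_left (le_of_lt ht)]
    field_simp
    ring
  rw [integral_Ioi_of_hasDerivAt_of_tendsto (by fun_prop) hd
    (integrable_ramp_mul_exp_neg hw).integrableOn hlim]
  simp

theorem integrable_shifted_ramp_mul_exp_neg {w : ℂ} (hw : 0 < w.re) (a : ℝ) :
    Integrable (fun t : ℝ => ((max (t - a) 0 : ℝ) : ℂ) * cexp (-(w * t))) := by
  refine (((integrable_ramp_mul_exp_neg hw).comp_sub_right a).mul_const (cexp (-(w * a)))).congr
    (ae_of_all _ fun t => ?_)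
  simp only
  rw [mul_assoc, ← Complex.exp_add]
  congr 2
  push_cast
  ring

theorem integral_shifted_ramp_mul_exp_neg {w : ℂ} (hw : 0 < w.re) (a : ℝ) :
    ∫ t : ℝ, ((max (t - a) 0 : ℝ) : ℂ) * cexp (-(w * t)) = cexp (-(w * a)) / w ^ 2 := by
  have h := integral_sub_right_eq_self
    (fun t : ℝ => ((max t 0 : ℝ) : ℂ) * cexp (-(w * t))) (μ := volume) a
  rw [integral_ramp_mul_exp_neg hw] at h
  rw [div_eq_mul_one_div, ← h, ← integral_const_mul]
  congr 1 with t
  rw [mul_left_comm, ← Complex.exp_add]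
  congr 2
  push_cast
  ring

theorem integral_norm_shifted_ramp_mul_exp_neg {w : ℂ} (hw : 0 < w.re) (a : ℝ) :
    ∫ t : ℝ, ‖((max (t - a) 0 : ℝ) : ℂ) * cexp (-(w * t))‖ =
      Real.exp (-(w.re * a)) / w.re ^ 2 := by
  have h := integral_shifted_ramp_mul_exp_neg (w := (w.re : ℂ)) (by simpa using hw) a
  rw [← Complex.ofReal_inj, ← integral_complex_ofReal]
  push_cast
  rw [← h]
  congr 1 with t
  rw [norm_mul, Complex.norm_exp, Complex.norm_real, Real.norm_eq_abs,
    abs_of_nonneg (le_max_right _ _)]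
  push_cast
  congr 3
  simp

/-! ### Size and regularity of F(e^t)/e^t -/

theorem moebius_mul_ramp_eq_zero {t : ℝ} {N n : ℕ} (hN : ⌊Real.exp t⌋₊ ≤ N)
    (hn : n ∉ Finset.Icc 1 N) :
    (ArithmeticFunction.moebius n : ℝ) * max (t - Real.log n) 0 = 0 := by
  rcases Nat.eq_zero_or_pos n with rfl | hpos
  · simp
  have h1 : ⌊Real.exp t⌋₊ < n := by
    rw [Finset.mem_Icc] at hn
    omega
  have h2 : t < Real.log n :=
    (Real.lt_log_iff_exp_lt (by exact_mod_cast hpos)).2 ((Nat.floor_lt (Real.exp_pos t).le).1 h1)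
  rw [max_eq_right (by linarith), mul_zero]

/-- Ramps remove the dependence of the summation range on t, which allows termwise integration and
comparison of two values of t. -/
theorem hasSum_calF_exp (t : ℝ) :
    HasSum (fun n : ℕ => (ArithmeticFunction.moebius n : ℝ) * max (t - Real.log n) 0)
      (calF (Real.exp t)) := by
  have e : calF (Real.exp t) = ∑ n ∈ Finset.Icc 1 ⌊Real.exp t⌋₊,
      (ArithmeticFunction.moebius n : ℝ) * max (t - Real.log n) 0 := by
    refine Finset.sum_congr rfl fun n hn => ?_
    rw [Finset.mem_Icc] at hn
    have hpos : (0 : ℝ) < n := by exact_mod_cast hn.1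
    have h1 : (n : ℝ) ≤ Real.exp t := (Nat.le_floor_iff (Real.exp_pos t).le).1 hn.2
    have h2 : Real.log n ≤ t := (Real.log_le_iff_le_exp hpos).2 h1
    rw [Real.log_div (Real.exp_pos t).ne' hpos.ne', Real.log_exp, max_eq_left (by linarith)]
  rw [e]
  exact hasSum_sum_of_ne_finset_zero fun n hn => moebius_mul_ramp_eq_zero le_rfl hn

theorem abs_moebius_cast_le_one (n : ℕ) : |(ArithmeticFunction.moebius n : ℝ)| ≤ 1 := by
  exact_mod_cast ArithmeticFunction.abs_moebius_le_one (n := n)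

/-- With N = ⌊x⌋, the sum of log(x/n) is log(x^N/N!), and x^N/N! is one term of the series of e^x.
-/
theorem abs_calF_le {x : ℝ} (hx : 0 ≤ x) : |calF x| ≤ x := by
  set N := ⌊x⌋₊ with hN
  rcases Nat.eq_zero_or_pos N with h0 | hNpos
  · simpa [calF, ← hN, h0] using hx
  have hx0 : 0 < x := lt_of_lt_of_le one_pos ((Nat.one_le_floor_iff x).1 hNpos)
  have hfact : ∏ n ∈ Finset.Icc 1 N, n = N.factorial := by
    rw [← Finset.prod_range_add_one_eq_factorial, Finset.range_eq_Ico, Finset.prod_Ico_add' (fun i => i),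
      zero_add, ← Finset.Ico_add_one_right_eq_Icc]
  have hsum : ∑ n ∈ Finset.Icc 1 N, Real.log (x / n) = Real.log (x ^ N / N.factorial) := by
    rw [← Real.log_prod, Finset.prod_div_distrib, Finset.prod_const, Nat.card_Icc,
      Nat.add_sub_cancel, ← Nat.cast_prod, hfact]
    intro n hn
    rw [Finset.mem_Icc] at hn
    have : (0 : ℝ) < n := by exact_mod_cast hn.1
    positivity
  calc |calF x| ≤ ∑ n ∈ Finset.Icc 1 N, Real.log (x / n) := by
        refine (Finset.abs_sum_le_sum_abs _ _).trans (Finset.sum_le_sum fun n hn => ?_)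
        rw [Finset.mem_Icc] at hn
        have hpos : (0 : ℝ) < n := by exact_mod_cast hn.1
        have h1 : (n : ℝ) ≤ x := (Nat.le_floor_iff hx).1 hn.2
        have h2 : 0 ≤ Real.log (x / n) := Real.log_nonneg ((one_le_div hpos).2 h1)
        rw [abs_mul, abs_of_nonneg h2]
        exact mul_le_of_le_one_left h2 (abs_moebius_cast_le_one n)
    _ ≤ x := by
        rw [hsum, Real.log_le_iff_le_exp (by positivity)]
        exact Real.pow_div_factorial_le_exp x hx N

theorem abs_calF_exp_sub_le {s t : ℝ} (hst : s ≤ t) :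
    |calF (Real.exp t) - calF (Real.exp s)| ≤ Real.exp t * (t - s) := by
  set N := ⌊Real.exp t⌋₊ with hN
  have hsN : ⌊Real.exp s⌋₊ ≤ N := Nat.floor_le_floor (Real.exp_le_exp.2 hst)
  have ht := (hasSum_calF_exp t).unique
    (hasSum_sum_of_ne_finset_zero fun n hn => moebius_mul_ramp_eq_zero hN.ge hn)
  have hs := (hasSum_calF_exp s).unique
    (hasSum_sum_of_ne_finset_zero fun n hn => moebius_mul_ramp_eq_zero hsN hn)
  rw [ht, hs, ← Finset.sum_sub_distrib]
  calc _ ≤ ∑ n ∈ Finset.Icc 1 N, (t - s) := by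
        refine (Finset.abs_sum_le_sum_abs _ _).trans (Finset.sum_le_sum fun n _ => ?_)
        rw [← mul_sub, abs_mul]
        have h1 := abs_max_sub_max_le_abs (t - Real.log n) (s - Real.log n) 0
        rw [sub_sub_sub_cancel_right, abs_of_nonneg (sub_nonneg.2 hst)] at h1
        calc _ ≤ 1 * (t - s) :=
              mul_le_mul (abs_moebius_cast_le_one n) h1 (abs_nonneg _) zero_le_one
          _ = _ := one_mul _
    _ = N * (t - s) := by simp [-Finset.sum_sub_distrib]
    _ ≤ _ := mul_le_mul_of_nonneg_right (Nat.floor_le (Real.exp_pos t).le) (sub_nonneg.2 hst)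

/-- The increment of F and the change of the denominator each contribute at most |s - t|; the second
uses 1 - e^{s-t} ≤ t - s. -/
theorem abs_calF_exp_div_exp_sub_le (s t : ℝ) :
    |calF (Real.exp s) / Real.exp s - calF (Real.exp t) / Real.exp t| ≤ 2 * |s - t| := by
  wlog hst : s ≤ t generalizing s t
  · rw [abs_sub_comm, abs_sub_comm s t]
    exact this t s (le_of_not_ge hst)
  have h1 := abs_calF_exp_sub_le hst
  have h2 := abs_calF_le (Real.exp_pos s).le
  have hes := Real.exp_pos s
  have het := Real.exp_pos t
  have hle := Real.exp_le_exp.2 hst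
  have hratio : 1 - Real.exp s / Real.exp t ≤ t - s := by
    rw [← Real.exp_sub]
    linarith [Real.add_one_le_exp (s - t)]
  have e : calF (Real.exp s) / Real.exp s - calF (Real.exp t) / Real.exp t =
      -((calF (Real.exp t) - calF (Real.exp s)) / Real.exp t) +
        calF (Real.exp s) * (1 / Real.exp s - 1 / Real.exp t) := by ring
  have hnn : 0 ≤ 1 / Real.exp s - 1 / Real.exp t :=
    sub_nonneg.2 (one_div_le_one_div_of_le hes hle)
  rw [e, abs_sub_comm s t, abs_of_nonneg (sub_nonneg.2 hst)]
  refine (abs_add_le _ _).trans ?_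
  rw [abs_neg, abs_div, abs_of_pos het, abs_mul, abs_of_nonneg hnn]
  have h3 : |calF (Real.exp t) - calF (Real.exp s)| / Real.exp t ≤ t - s := by
    rw [div_le_iff₀ het]; linarith
  have h4 : |calF (Real.exp s)| * (1 / Real.exp s - 1 / Real.exp t) ≤ t - s :=
    (mul_le_mul_of_nonneg_right h2 hnn).trans (le_trans (le_of_eq (by field_simp)) hratio)
  linarith

theorem calF_exp_of_nonpos {t : ℝ} (ht : t ≤ 0) : calF (Real.exp t) = 0 := by
  refine (hasSum_calF_exp t).unique ?_
  convert! hasSum_zero (α := ℝ) (β := ℕ) with n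
  rw [max_eq_right (by linarith [Real.log_natCast_nonneg n]), mul_zero]

/-! ### The Laplace transform and the zeta function -/

theorem natCast_cpow_eq_exp {n : ℕ} (hn : n ≠ 0) (w : ℂ) :
    (n : ℂ) ^ w = cexp (w * (Real.log n : ℝ)) := by
  rw [Complex.cpow_def_of_ne_zero (by exact_mod_cast hn), Complex.natCast_log, mul_comm]

theorem LSeries_moebius_eq_inv_riemannZeta {s : ℂ} (hs : 1 < s.re) :
    LSeries (fun n => (ArithmeticFunction.moebius n : ℂ)) s = (riemannZeta s)⁻¹ := by
  have h := LSeries_one_mul_Lseries_moebius hs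
  rw [LSeries_one_eq_riemannZeta hs] at h
  exact eq_inv_of_mul_eq_one_right h

/-- Dividing by e^u shifts z to w = 1 + z. The ramp at log n has transform n^{-w}/w^2, and absolute
convergence for Re w > 1 justifies the interchange. -/
theorem integral_calF_exp_div_exp_mul_exp_neg {z : ℂ} (hz : 0 < z.re) :
    ∫ u in Ioi (0 : ℝ), ((calF (Real.exp u) / Real.exp u : ℝ) : ℂ) * cexp (-(z * u)) =
      (riemannZeta (1 + z))⁻¹ / (1 + z) ^ 2 := by
  set w : ℂ := 1 + z with hwdef
  have hw1 : 1 < w.re := by simpa [hwdef] using hz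
  have hw : 0 < w.re := one_pos.trans hw1
  have hsummable := ArithmeticFunction.LSeriesSummable_moebius_iff.2 hw1
  rw [setIntegral_eq_integral_of_forall_compl_eq_zero
    (fun t ht => by simp [calF_exp_of_nonpos (not_lt.1 ht)])]
  set f : ℕ → ℝ → ℂ := fun n t => (ArithmeticFunction.moebius n : ℂ) *
    (((max (t - Real.log n) 0 : ℝ) : ℂ) * cexp (-(w * t))) with hf
  have hterm : ∀ n, ∫ t, f n t =
      LSeries.term (fun n => (ArithmeticFunction.moebius n : ℂ)) w n / w ^ 2 := by
    intro n
    rw [hf, integral_const_mul, integral_shifted_ramp_mul_exp_neg hw]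
    rcases eq_or_ne n 0 with rfl | hn
    · simp
    rw [LSeries.term_of_ne_zero hn, natCast_cpow_eq_exp hn, Complex.exp_neg]
    ring
  have hnorm : ∀ n, ∫ t, ‖f n t‖ =
      ‖LSeries.term (fun n => (ArithmeticFunction.moebius n : ℂ)) w n‖ / w.re ^ 2 := by
    intro n
    simp only [hf, norm_mul (ArithmeticFunction.moebius n : ℂ)]
    rw [integral_const_mul, integral_norm_shifted_ramp_mul_exp_neg hw]
    rcases eq_or_ne n 0 with rfl | hn
    · simp
    rw [LSeries.term_of_ne_zero hn, natCast_cpow_eq_exp hn, norm_div, Complex.norm_exp,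
      Real.exp_neg, re_mul_ofReal]
    ring
  have key := hasSum_integral_of_summable_integral_norm (F := f) (μ := volume)
    (fun n => (integrable_shifted_ramp_mul_exp_neg hw _).const_mul _)
    (by simp_rw [hnorm]; exact hsummable.norm.div_const _)
  simp_rw [hterm] at key
  have hval := (hsummable.hasSum.div_const (w ^ 2)).unique key
  rw [← LSeries_moebius_eq_inv_riemannZeta hw1]
  refine Eq.trans ?_ hval.symm
  congr 1 with t
  have hs := (((Complex.hasSum_ofReal.2 (hasSum_calF_exp t)).mul_right (cexp (-(w * t)))))
  have he : cexp (-(w * t)) = cexp (-(z * t)) / Real.exp t := by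
    rw [hwdef, Complex.ofReal_exp, ← Complex.exp_sub]
    congr 1
    ring
  have : HasSum (fun n => f n t) ((calF (Real.exp t) : ℂ) * cexp (-(w * t))) := by
    convert! hs using 2 with n
    simp only [hf]
    push_cast
    ring
  rw [this.tsum_eq, he]
  push_cast
  ring

/-- Non-vanishing of ζ on Re s ≥ 1 is the deep input. At 1 the value of `riemannZeta` is a
convention, so the limit 0 dictated by the pole is put in by hand. -/
theorem continuousOn_update_inv_riemannZeta :
    ContinuousOn (Function.update (fun s => (riemannZeta s)⁻¹) 1 0) {s | 1 ≤ s.re} := by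
  intro s hs
  refine ContinuousAt.continuousWithinAt ?_
  rcases eq_or_ne s 1 with rfl | hs1
  · rw [continuousAt_update_same]
    have h1 : Tendsto (fun s : ℂ => (s - 1) * ((s - 1) * riemannZeta s)⁻¹) (𝓝[≠] 1) (𝓝 0) := by
      have : Tendsto (fun s : ℂ => s - 1) (𝓝[≠] 1) (𝓝 0) := by
        have : Continuous fun s : ℂ => s - 1 := by fun_prop
        simpa using (this.tendsto 1).mono_left nhdsWithin_le_nhds
      simpa using this.mul (riemannZeta_residue_one.inv₀ one_ne_zero)
    refine h1.congr' ?_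
    filter_upwards [self_mem_nhdsWithin] with s hs
    rw [mul_inv, mul_inv_cancel_left₀ (sub_ne_zero.2 hs)]
  · rw [continuousAt_update_of_ne hs1]
    exact (differentiableAt_riemannZeta hs1).continuousAt.inv₀
      (riemannZeta_ne_zero_of_one_le_re hs)

theorem tendsto_calF_exp_div_exp :
    Tendsto (fun t : ℝ => calF (Real.exp t) / Real.exp t) atTop (𝓝 0) := by
  refine tendsto_zero_of_laplace_continuousOn (C := 1) (L := 2)
    (G := fun z => Function.update (fun s => (riemannZeta s)⁻¹) 1 0 (1 + z) / (1 + z) ^ 2)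
    (fun t => ?_) abs_calF_exp_div_exp_sub_le (fun t ht => ?_) ?_ fun z hz => ?_
  · rw [abs_div, abs_of_pos (Real.exp_pos t)]
    exact div_le_one_of_le₀ (abs_calF_le (Real.exp_pos t).le) (Real.exp_pos t).le
  · rw [calF_exp_of_nonpos ht, zero_div]
  · refine ContinuousOn.div (continuousOn_update_inv_riemannZeta.comp (by fun_prop) fun z hz => ?_)
      (by fun_prop) fun z hz => ?_
    · have hz' : 0 ≤ z.re := hz
      simpa using hz'
    · have hz' : 0 ≤ z.re := hz
      refine pow_ne_zero 2 fun h => ?_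
      have := congrArg Complex.re h
      simp at this
      linarith
  · have hne : 1 + z ≠ 1 := fun h => by
      rw [add_eq_left] at h
      simp [h] at hz
    rw [integral_calF_exp_div_exp_mul_exp_neg hz, Function.update_of_ne hne]

theorem theorem1 : ell = 0 := by
  have h : Tendsto (fun x : ℝ => |calH x|) atTop (𝓝 0) := by
    simpa [calH] using (tendsto_calF_exp_div_exp.comp Real.tendsto_sqrt_atTop).abs
  exact (EReal.tendsto_coe.2 h).limsup_eq
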